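/- Let $\alpha\in\mathbb C$ and $a>1$ satisfy $0<|\alpha|<1$ and $|\alpha|^2+a^{-2}=1$. On $\ell^2(\mathbb Z)$ with canonical basis $(e_k)_{k\in\mathbb Z}$ let $Te_k=e_{k+1}$ and $Ae_k=ke_k$, and let $$H_a=\frac1a\,T^*-|\alpha|^2\sum_{j\ge 0}\Big(\frac Ta\Big)^j=F_a(T),\qquad F_a(z)=\frac{1-az}{z(a-z)},$$ be the GGT matrix with constant Verblunsky coefficients $\alpha_k=\alpha$, that is $H_ae_k=\frac1a e_{k-1}-\bar\alpha\sum_{i\ge k}\alpha\, a^{-(i-k)}e_i$. Let $B_a$ be the closure of the symmetric operator $(aT+aT^*-2)A+A(aT+aT^*-2)$ defined on the linear span of the $e_k$ (this closure is self-adjoint). Let $f_a(\theta)=F_a(e^{i\theta})$, $\theta_a=\arccos(a^{-1})$, and let $\Theta_a=\{e^{i\theta}:\arg f_a(-\theta_a)\le\theta\le\arg f_a(\theta_a)\}$, with $\arg$ taking values in $[0,2\pi)$. For a self-adjoint operator $B$ and a unitary operator $U$ of class $C^1(B)$ (i.e. the form $\langle B\varphi,U\psi\rangle-\langle\varphi,UB\psi\rangle$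 on $\mathcal D(B)\times\mathcal D(B)$ is the form of a bounded operator $\mathrm{ad}_BU$), write $U^*BU-B$ for the bounded operator $U^*(\mathrm{ad}_BU)$. Let $E_\Theta$ denote the spectral projections of $U$. One says that $U$ is weakly propagating with respect to $B$ if $U^*BU-B$ is non-negative and injective, and strictly propagating with respect to $B$ on a Borel set $\Theta$ of the circle if there is $c>0$ with $E_\Theta(U^*BU-B)E_\Theta\ge cE_\Theta$. Then $H_a$ is unitary and of class $C^1(B_a)$, and: 1. $H_a$ is weakly propagating with respect to $B_a$; 2. $H_a$ is strictly propagating with respect to $B_a$ on every subarc $\Theta$ of $\Theta_a$ whose closure contains neither endpoint of $\Theta_a$. Consequently, $H_a$ has purely absolutely continuous spectrum. -/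

import Mathlib

open MeasureTheory
open scoped InnerProductSpace ComplexConjugate

noncomputable section

namespace GGT

/-! ### The torus and spectral families of unitary operators -/

/-- The one-dimensional torus `ℝ / 2πℤ`. -/
abbrev Torus : Type := AddCircle (2 * Real.pi)

instance factTwoPiPos : Fact (0 < 2 * Real.pi) := ⟨Real.two_pi_pos⟩

section Abstract

variable {E : Type*} [NormedAddCommGroup E] [InnerProductSpace ℂ E] [CompleteSpace E]

/-- The spectral family of `U`: a projection-valued Borel measure `Δ ↦ E_Δ` on the torus with
`U = ∫ e^{iθ} dE(θ)`. The scalar measures `⟨φ, E_Δ φ⟩ = ‖E_Δ φ‖²` are carried as `measure φ`;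
only the values of `proj` on Borel sets are meaningful. -/
structure SpectralFamily (U : E →L[ℂ] E) where
  proj : Set Torus → E →L[ℂ] E
  isStarProjection_proj : ∀ Δ, MeasurableSet Δ → IsStarProjection (proj Δ)
  proj_univ : proj Set.univ = 1
  measure : E → Measure Torus
  measure_apply : ∀ φ Δ, MeasurableSet Δ → measure φ Δ = ENNReal.ofReal (‖proj Δ φ‖ ^ 2)
  inner_eq_integral : ∀ φ, ⟪φ, U φ⟫_ℂ = ∫ θ, (AddCircle.toCircle θ : ℂ) ∂(measure φ)

/-- `U` has purely absolutely continuous spectrum: every spectral measure of `U` is absolutely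
continuous with respect to Lebesgue measure on the torus. -/
def HasPurelyACSpectrum (U : E →L[ℂ] E) : Prop :=
  ∃ P : SpectralFamily U, ∀ φ, P.measure φ ≪ (volume : Measure Torus)

/-! ### Commutators and propagation -/

/-- The bounded operator `C` is `ad_A B = [A, B]`: on the domain of `A` the sesquilinear form
`⟨A φ, B ψ⟩ - ⟨φ, B A ψ⟩` is that of `C`. A bounded `B` is of class `C¹(A)` if such a `C` exists;
for densely defined `A` it is then unique. -/
def IsCommutator (A : E →ₗ.[ℂ] E) (B C : E →L[ℂ] E) : Prop :=
  ∀ φ ψ : A.domain, ⟪A φ, B ψ⟫_ℂ - ⟪(φ : E), B (A ψ)⟫_ℂ = ⟪(φ : E), C ψ⟫_ℂ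

/-- The bounded operator `D` is `U* A U - A`, that is `U* (ad_A U)`, where `A` is self-adjoint and
`U` is a unitary operator of class `C¹(A)`. -/
def IsConjugationDefect (A : E →ₗ.[ℂ] E) (U D : E →L[ℂ] E) : Prop :=
  IsSelfAdjoint A ∧ U ∈ unitary (E →L[ℂ] E) ∧
    ∃ C : E →L[ℂ] E, IsCommutator A U C ∧ D = ContinuousLinearMap.adjoint U ∘L C

/-- `U` is weakly propagating with respect to `A`: `U* A U - A` is non-negative and injective. -/
def IsWeaklyPropagating (U : E →L[ℂ] E) (A : E →ₗ.[ℂ] E) : Prop :=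
  ∃ D : E →L[ℂ] E, IsConjugationDefect A U D ∧ D.IsPositive ∧ Function.Injective D

/-- `U` is strictly propagating with respect to `A` on the Borel set `Θ`:
`E_Θ (U* A U - A) E_Θ ≥ c E_Θ` for some `c > 0`. -/
def IsStrictlyPropagatingOn (U : E →L[ℂ] E) (A : E →ₗ.[ℂ] E) (Θ : Set Torus) : Prop :=
  MeasurableSet Θ ∧ ∃ D : E →L[ℂ] E, IsConjugationDefect A U D ∧
    ∃ P : SpectralFamily U, ∃ c : ℝ, 0 < c ∧
      (P.proj Θ ∘L D ∘L P.proj Θ - (c : ℂ) • P.proj Θ).IsPositive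

/-- Precomposition of an unbounded operator with a bounded one, on its natural domain
`{u | G u ∈ D(A)}`. -/
def precomp (A : E →ₗ.[ℂ] E) (G : E →L[ℂ] E) : E →ₗ.[ℂ] E where
  domain := A.domain.comap (G : E →ₗ[ℂ] E)
  toFun := A.toFun ∘ₗ (G : E →ₗ[ℂ] E).restrict (fun _ hx => hx)

end Abstract

/-! ### Operators on `ℓ²(ℤ)` -/

/-- The Hilbert space `ℓ²(ℤ)`. -/
abbrev EllTwo : Type := lp (fun _ : ℤ => ℂ) 2

/-- The canonical orthonormal basis. -/
def e (k : ℤ) : EllTwo := lp.single 2 k 1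

theorem memℓp_shift (n : ℤ) (u : EllTwo) : Memℓp (fun k : ℤ => u (k + n)) 2 := by
  have h := (memℓp_gen_iff (p := 2) (by norm_num)).1 (lp.memℓp u)
  exact (memℓp_gen_iff (p := 2) (by norm_num)).2 ((Equiv.addRight n).summable_iff.2 h)

/-- `u ↦ (u (k + n))_k`, as a linear isometry. -/
def shiftIsometry (n : ℤ) : EllTwo →ₗᵢ[ℂ] EllTwo where
  toFun u := ⟨fun k => u (k + n), memℓp_shift n u⟩
  map_add' _ _ := rfl
  map_smul' _ _ := rfl
  norm_map' u := by
    have h : (0 : ℝ) < (2 : ENNReal).toReal := by norm_num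
    refine (Real.rpow_left_inj (norm_nonneg _) (norm_nonneg _) h.ne').1 ?_
    rw [lp.norm_rpow_eq_tsum h, lp.norm_rpow_eq_tsum h]
    exact (Equiv.addRight n).tsum_eq (fun k => ‖u k‖ ^ (2 : ENNReal).toReal)

/-- The shift `T`, with `T e_k = e_{k+1}`. -/
def T : EllTwo →L[ℂ] EllTwo := (shiftIsometry (-1)).toContinuousLinearMap

/-- The position operator `A`, with `A e_k = k e_k`, on its maximal domain. -/
def position : EllTwo →ₗ.[ℂ] EllTwo where
  domain :=
    { carrier := {u | Memℓp (fun k : ℤ => (k : ℂ) * u k) 2}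
      add_mem' := fun {u v} hu hv => by
        have h : (fun k : ℤ => (k : ℂ) * (u + v) k) =
            (fun k : ℤ => (k : ℂ) * u k) + fun k : ℤ => (k : ℂ) * v k := by
          funext k; simp [mul_add]
        simpa only [Set.mem_ofPred_eq, h] using hu.add hv
      zero_mem' := by
        have h : (fun k : ℤ => (k : ℂ) * (0 : EllTwo) k) = 0 := by
          funext k; simp
        simpa only [Set.mem_ofPred_eq, h] using zero_memℓp
      smul_mem' := fun c u hu => by
        have h : (fun k : ℤ => (k : ℂ) * (c • u) k) = c • fun k : ℤ => (k : ℂ) * u k := by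
          funext k; simp [mul_left_comm]
        simpa only [Set.mem_ofPred_eq, h] using hu.const_smul c }
  toFun :=
    { toFun := fun u => ⟨fun k => (k : ℂ) * (u : EllTwo) k, u.2⟩
      map_add' := fun u v => by ext k; exact mul_add _ _ _
      map_smul' := fun c u => by ext k; simp [mul_left_comm] }

/-- `H` is the GGT representation with Verblunsky coefficients `α`, where `|α_k|² + a_k⁻² = 1`:
`H e_k = a_k⁻¹ e_{k-1} - conj α_k ∑_{i ≥ k} α_{i+1} (∏_{k < j ≤ i} a_j⁻¹) e_i`. -/
def IsGGTRepresentation (α : ℤ → ℂ) (a : ℤ → ℝ) (H : EllTwo →L[ℂ] EllTwo) : Prop :=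
  (∀ k, ‖α k‖ ^ 2 + ((a k) ^ 2)⁻¹ = 1) ∧ ∀ k : ℤ, ∃ S : EllTwo,
    HasSum (fun n : ℕ =>
      (α (k + n + 1) * ∏ j ∈ Finset.Ioc k (k + n), ((a j : ℂ))⁻¹) • e (k + n)) S ∧
    H (e k) = ((a k : ℂ))⁻¹ • e (k - 1) - conj (α k) • S

/-- The GGT matrix with constant coefficients,
`H_a = a⁻¹ T* - |α|² ∑_{j ≥ 0} (T / a)^j`, where `|α|² + a⁻² = 1`. -/
def constGGT (α : ℂ) (a : ℝ) : EllTwo →L[ℂ] EllTwo :=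
  (a : ℂ)⁻¹ • ContinuousLinearMap.adjoint T
    - ((‖α‖ ^ 2 : ℝ) : ℂ) • ∑' j : ℕ, ((a : ℂ)⁻¹ • T) ^ j

/-- `F_a(z) = (1 - a z) / (z (a - z))`. -/
def symbol (a : ℝ) (z : ℂ) : ℂ := (1 - a * z) / (z * (a - z))

/-- `G_a(T) = a T + a T* - 2`. -/
def G (a : ℝ) : EllTwo →L[ℂ] EllTwo :=
  (a : ℂ) • T + (a : ℂ) • ContinuousLinearMap.adjoint T
    - (2 : ℂ) • ContinuousLinearMap.id ℂ EllTwo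

/-- The symmetric operator `G_a(T) A + A G_a(T)` on the linear span of the `e_k`. -/
def conjugateOpCore (a : ℝ) : EllTwo →ₗ.[ℂ] EllTwo :=
  ((G a : EllTwo →ₗ[ℂ] EllTwo).compPMap position + precomp position (G a)).domRestrict
    (Submodule.span ℂ (Set.range e))

/-- The conjugate operator `B_a`: the closure of `G_a(T) A + A G_a(T)`. -/
def conjugateOp (a : ℝ) : EllTwo →ₗ.[ℂ] EllTwo := (conjugateOpCore a).closure

/-! ### The arc `Θ_a` -/

/-- The argument of a complex number in `[0, 2π)`. -/
def argPos (z : ℂ) : ℝ := toIcoMod Real.two_pi_pos 0 z.arg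

/-- `f_a(θ) = F_a(e^{iθ})`. -/
def circleSymbol (a θ : ℝ) : ℂ := symbol a (Circle.exp θ)

/-- The lower endpoint `arg f_a(-θ_a)` of `Θ_a`, where `θ_a = arccos a⁻¹`. -/
def arcLower (a : ℝ) : ℝ := argPos (circleSymbol a (-Real.arccos a⁻¹))

/-- The upper endpoint `arg f_a(θ_a)` of `Θ_a`. -/
def arcUpper (a : ℝ) : ℝ := argPos (circleSymbol a (Real.arccos a⁻¹))

/-- The arc `Θ_a`, as a subset of the torus. -/
def arc (a : ℝ) : Set Torus := (fun θ : ℝ => (θ : Torus)) '' Set.Icc (arcLower a) (arcUpper a)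

/-- A (possibly open, closed, half-open or degenerate) arc of the torus. -/
def IsArc (Θ : Set Torus) : Prop :=
  ∃ I : Set ℝ, I.OrdConnected ∧ Θ = (fun θ : ℝ => (θ : Torus)) '' I

end GGT

end

/-! Under the Fourier isomorphism `ℓ²(ℤ) ≃ L²(𝕋)`, `T` is multiplication by `z = e^{iθ}`, so `H_a`
is multiplication by `F_a(e^{iθ}) = e^{iφ(θ)}` for a smooth real phase `φ`, and `A` is `-i d/dθ`.
The commutator with `G_a(T) A + A G_a(T)` then produces
`H_a* B_a H_a - B_a = 2 G_a(e^{iθ}) φ'(θ)`, where `G_a(e^{iθ}) = 2 (a cos θ - 1)` and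
`φ' = G_a(e^{iθ}) / |a - e^{iθ}|²`. This is nonnegative and vanishes only at the two points `±θ_a`,
which gives weak propagation; it is bounded below wherever `e^{iφ}` stays away from
`e^{iφ(±θ_a)}`, the endpoints of `Θ_a`, which gives strict propagation. Since `φ' ≠ 0` almost
everywhere, null sets have null preimages under `φ`, and the spectrum is absolutely continuous. -/

noncomputable section

namespace GGT

section Multiplication

variable {X : Type*} [MeasurableSpace X] {μ : Measure X}

/-- The star algebra of essentially bounded functions. Its elements are functions rather than
classes modulo null sets, so that the algebraic operations are pointwise. -/
def essBounded (μ : Measure X) : StarSubalgebra ℂ (X → ℂ) where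
  carrier := {g | MemLp g ⊤ μ}
  mul_mem' hg hh := hh.mul hg
  add_mem' hg hh := hg.add hh
  algebraMap_mem' c := memLp_top_const c
  star_mem' hg := hg.star

variable {E : Type*} [NormedAddCommGroup E] [InnerProductSpace ℂ E]
  (V : E ≃ₗᵢ[ℂ] Lp ℂ 2 μ)

/-- The underlying map of `multiplier`. -/
def mulOperator (g : essBounded μ) : E →L[ℂ] E :=
  (V.symm.toContinuousLinearEquiv : Lp ℂ 2 μ →L[ℂ] E) ∘L
    (ContinuousLinearMap.mul ℂ ℂ).holderL μ ⊤ 2 2 (MemLp.toLp g.1 g.2) ∘L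
    (V.toContinuousLinearEquiv : E →L[ℂ] Lp ℂ 2 μ)

theorem coeFn_mulOperator (g : essBounded μ) (u : E) :
    V (mulOperator V g u) =ᵐ[μ] fun x => g.1 x * V u x := by
  have h : V (mulOperator V g u) =
      (ContinuousLinearMap.mul ℂ ℂ).holder 2 (MemLp.toLp g.1 g.2) (V u) := by
    simp [mulOperator, ContinuousLinearMap.holderL, ContinuousLinearMap.holderₗ]
  rw [h]
  filter_upwards [(ContinuousLinearMap.mul ℂ ℂ).coeFn_holder (r := 2) (MemLp.toLp g.1 g.2) (V u),
    MemLp.coeFn_toLp g.2] with x h1 h2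
  rw [h1, h2, ContinuousLinearMap.mul_apply']

theorem eq_mulOperator {g : essBounded μ} {A : E →L[ℂ] E}
    (h : ∀ u, V (A u) =ᵐ[μ] fun x => g.1 x * V u x) : mulOperator V g = A := by
  ext1 u
  exact V.injective (Lp.ext ((coeFn_mulOperator V g u).trans (h u).symm))

variable [CompleteSpace E]

/-- Multiplication by essentially bounded functions in the spectral representation `V`. -/
def multiplier : essBounded μ →⋆ₐ[ℂ] (E →L[ℂ] E) where
  toFun := mulOperator V
  map_one' := eq_mulOperator V fun u => .of_forall fun x => (one_mul _).symm
  map_mul' g h := eq_mulOperator V fun u => by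
    filter_upwards [coeFn_mulOperator V g (mulOperator V h u), coeFn_mulOperator V h u]
      with x h1 h2
    simp only [mul_apply_eq_comp, h1, h2, MulMemClass.coe_mul, Pi.mul_apply, mul_assoc]
  map_zero' := eq_mulOperator V fun u => by
    rw [zero_apply, map_zero]
    filter_upwards [Lp.coeFn_zero ℂ 2 μ] with x h1
    rw [h1]
    exact (zero_mul _).symm
  map_add' g h := eq_mulOperator V fun u => by
    rw [add_apply, map_add]
    filter_upwards [coeFn_mulOperator V g u, coeFn_mulOperator V h u,
      Lp.coeFn_add (V (mulOperator V g u)) (V (mulOperator V h u))] with x h1 h2 h3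
    rw [h3, Pi.add_apply, h1, h2]
    exact (add_mul _ _ _).symm
  commutes' c := eq_mulOperator V fun u => by
    rw [Algebra.algebraMap_eq_smul_one, smul_apply, one_apply_eq_self, map_smul]
    filter_upwards [Lp.coeFn_smul c (V u)] with x h1
    rw [h1]
    rfl
  map_star' g := by
    rw [ContinuousLinearMap.star_eq_adjoint, ContinuousLinearMap.eq_adjoint_iff]
    intro u v
    rw [← V.inner_map_map, ← V.inner_map_map u, L2.inner_def, L2.inner_def]
    refine integral_congr_ae ?_
    filter_upwards [coeFn_mulOperator V g v, coeFn_mulOperator V (star g) u] with x h1 h2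
    rw [h1, h2]
    simp only [RCLike.inner_apply, map_mul, StarMemClass.coe_star, Pi.star_apply,
      RCLike.star_def, RCLike.conj_conj]
    ring

theorem coeFn_multiplier (g : essBounded μ) (u : E) :
    V (multiplier V g u) =ᵐ[μ] fun x => g.1 x * V u x :=
  coeFn_mulOperator V g u

theorem inner_multiplier_self (g : essBounded μ) (u : E) :
    ⟪u, multiplier V g u⟫_ℂ = ∫ x, g.1 x * (‖V u x‖ ^ 2 : ℝ) ∂μ := by
  rw [← V.inner_map_map, L2.inner_def]
  refine integral_congr_ae ?_
  filter_upwards [coeFn_multiplier V g u] with x h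
  rw [h, RCLike.inner_apply, mul_assoc, Complex.mul_conj', Complex.ofReal_pow]

theorem isPositive_multiplier {g : essBounded μ} {d : X → ℝ} (hg : ∀ x, g.1 x = d x)
    (hd : ∀ x, 0 ≤ d x) : (multiplier V g).IsPositive := by
  have hsa : IsSelfAdjoint (multiplier V g) := by
    refine IsSelfAdjoint.map (x := g) (Subtype.ext (funext fun x => ?_)) (multiplier V)
    simp [hg]
  refine ContinuousLinearMap.isPositive_def'.2 ⟨hsa, fun u => ?_⟩
  have h : ⟪u, multiplier V g u⟫_ℂ = (∫ x, d x * ‖V u x‖ ^ 2 ∂μ : ℝ) := by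
    rw [inner_multiplier_self, ← integral_complex_ofReal]
    simp only [hg, Complex.ofReal_mul]
  rw [ContinuousLinearMap.reApplyInnerSelf_apply, ← inner_conj_symm, RCLike.conj_re, h]
  exact integral_nonneg fun x => mul_nonneg (hd x) (sq_nonneg _)

theorem injective_multiplier {g : essBounded μ} (hg : ∀ᵐ x ∂μ, g.1 x ≠ 0) :
    Function.Injective (multiplier V g) := by
  refine (injective_iff_map_eq_zero _).2 fun u hu => V.injective (Lp.ext ?_)
  have h := coeFn_multiplier V g u
  rw [hu, map_zero] at h
  rw [map_zero]
  filter_upwards [hg, h, Lp.coeFn_zero ℂ 2 μ] with x h0 h1 h2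
  rw [h2, Pi.zero_apply] at h1 ⊢
  exact (mul_eq_zero.1 h1.symm).resolve_left h0

end Multiplication

theorem continuous_coe_toCircle :
    Continuous fun θ : Torus => (AddCircle.toCircle θ : ℂ) :=
  continuous_subtype_val.comp AddCircle.continuous_toCircle

section SpectralRepresentation

variable {X : Type*} [MeasurableSpace X] {μ : Measure X} {φ : X → Torus} (hφ : Measurable φ)

/-- The unimodular function `e^{iφ}`. -/
def expPhase : essBounded μ where
  val x := AddCircle.toCircle (φ x)
  property := memLp_top_of_bound (continuous_coe_toCircle.measurable.comp hφ).aestronglyMeasurable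
    1 (.of_forall fun _ => (Circle.norm_coe _).le)

open scoped Classical in
/-- The indicator function of `S`, and the junk value `0` if `S` is not measurable. -/
def indicatorOne (S : Set X) : essBounded μ :=
  if hS : MeasurableSet S then ⟨S.indicator 1, (memLp_top_const 1).indicator hS⟩ else 0

theorem coe_indicatorOne {S : Set X} (hS : MeasurableSet S) :
    (indicatorOne S : essBounded μ).1 = S.indicator 1 := by
  rw [indicatorOne, dif_pos hS]

theorem isStarProjection_indicatorOne {S : Set X} (hS : MeasurableSet S) :
    IsStarProjection (indicatorOne S : essBounded μ) := by
  refine ⟨Subtype.ext ?_, Subtype.ext ?_⟩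
  all_goals
    simp only [MulMemClass.coe_mul, StarMemClass.coe_star, coe_indicatorOne hS]
    ext x
    by_cases hx : x ∈ S <;> simp [hx]

variable {E : Type*} [NormedAddCommGroup E] [InnerProductSpace ℂ E] [CompleteSpace E]
  (V : E ≃ₗᵢ[ℂ] Lp ℂ 2 μ)

theorem sq_norm_multiplier_indicatorOne {S : Set X} (hS : MeasurableSet S) (u : E) :
    ENNReal.ofReal (‖multiplier V (indicatorOne S) u‖ ^ 2) = ∫⁻ x in S, ‖V u x‖ₑ ^ 2 ∂μ := by
  rw [← V.norm_map, ENNReal.ofReal_pow (norm_nonneg _), ofReal_norm, Lp.enorm_def,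
    ← ENNReal.rpow_natCast, ← lintegral_indicator hS]
  have h := eLpNorm_nnreal_pow_eq_lintegral (μ := μ)
    (f := V (multiplier V (indicatorOne S) u)) (p := 2) two_ne_zero
  refine (h.trans (lintegral_congr_ae ?_))
  filter_upwards [coeFn_multiplier V (indicatorOne S) u] with x hx
  rw [hx, coe_indicatorOne hS]
  by_cases hxS : x ∈ S <;> simp [hxS]

/-- Multiplication by `e^{iφ}` in the spectral representation `V`. -/
def phaseOperator : E →L[ℂ] E := multiplier V (expPhase hφ)

/-- The spectral family of multiplication by `e^{iφ}`: the projection of a Borel set `Δ` is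
multiplication by the indicator function of `φ⁻¹(Δ)`. -/
def spectralFamily : SpectralFamily (phaseOperator hφ V) where
  proj Δ := multiplier V (indicatorOne (φ ⁻¹' Δ))
  isStarProjection_proj _ hΔ := (isStarProjection_indicatorOne (hφ hΔ)).map (multiplier V)
  proj_univ := by
    rw [← map_one (multiplier V)]
    exact congrArg _ (Subtype.ext ((coe_indicatorOne .univ).trans (Set.indicator_univ _)))
  measure u := (μ.withDensity fun x => ‖V u x‖ₑ ^ 2).map φ
  measure_apply u Δ hΔ := by
    rw [Measure.map_apply hφ hΔ, withDensity_apply _ (hφ hΔ),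
      sq_norm_multiplier_indicatorOne V (hφ hΔ)]
  inner_eq_integral u := by
    have hm : AEMeasurable (fun x => ‖V u x‖ₑ ^ 2) μ :=
      (Lp.aestronglyMeasurable (V u)).enorm.pow_const 2
    rw [integral_map hφ.aemeasurable continuous_coe_toCircle.aestronglyMeasurable,
      integral_withDensity_eq_integral_toReal_smul₀ hm
        (.of_forall fun _ => ENNReal.pow_lt_top enorm_lt_top), phaseOperator,
      inner_multiplier_self]
    simp [expPhase, mul_comm]

variable {hφ V} {A : E →ₗ.[ℂ] E} {d : essBounded μ} {δ : X → ℝ}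

theorem isWeaklyPropagating_phaseOperator
    (hA : IsConjugationDefect A (phaseOperator hφ V) (multiplier V d)) (hd : ∀ x, d.1 x = δ x)
    (hδ : ∀ x, 0 ≤ δ x) (hδ' : ∀ᵐ x ∂μ, δ x ≠ 0) :
    IsWeaklyPropagating (phaseOperator hφ V) A :=
  ⟨_, hA, isPositive_multiplier V hd hδ, injective_multiplier V <| by simpa [hd] using hδ'⟩

theorem isStrictlyPropagatingOn_phaseOperator {Θ : Set Torus} {c : ℝ}
    (hA : IsConjugationDefect A (phaseOperator hφ V) (multiplier V d)) (hd : ∀ x, d.1 x = δ x)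
    (hΘ : MeasurableSet Θ) (hc : 0 < c) (hcδ : ∀ x, φ x ∈ Θ → c ≤ δ x) :
    IsStrictlyPropagatingOn (phaseOperator hφ V) A Θ := by
  refine ⟨hΘ, _, hA, spectralFamily hφ V, c, hc, ?_⟩
  let p : essBounded μ := indicatorOne (φ ⁻¹' Θ)
  have h : multiplier V p * (multiplier V d * multiplier V p) - (c : ℂ) • multiplier V p =
      multiplier V (p * (d * p) - (c : ℂ) • p) := by simp only [map_sub, map_mul, map_smul]
  refine h ▸ isPositive_multiplier V (d := (φ ⁻¹' Θ).indicator fun x => δ x - c) (fun x => ?_)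
    (Set.indicator_nonneg fun x hx => sub_nonneg.2 (hcδ x hx))
  change p.1 x * (d.1 x * p.1 x) - (c : ℂ) * p.1 x = _
  by_cases hx : φ x ∈ Θ <;> simp [p, coe_indicatorOne (hφ hΘ), hd, hx]

theorem hasPurelyACSpectrum_phaseOperator (h : Measure.QuasiMeasurePreserving φ μ volume) :
    HasPurelyACSpectrum (phaseOperator h.measurable V) :=
  ⟨spectralFamily h.measurable V, fun _ =>
    ((withDensity_absolutelyContinuous _ _).map h.measurable).trans h.absolutelyContinuous⟩

end SpectralRepresentation

section Unbounded

variable {E : Type*} [NormedAddCommGroup E] [InnerProductSpace ℂ E]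

theorem adjoint_topologicalClosure (g : Submodule ℂ (E × E)) :
    g.topologicalClosure.adjoint = g.adjoint := by
  ext x
  simp only [Submodule.mem_adjoint_iff]
  refine ⟨fun hx u v huv => hx u v (g.le_topologicalClosure huv), fun hx u v huv => ?_⟩
  have hc : IsClosed {p : E × E | ⟪p.2, x.1⟫_ℂ - ⟪p.1, x.2⟫_ℂ = 0} :=
    isClosed_eq (by fun_prop) continuous_const
  exact closure_minimal (fun p hp => hx p.1 p.2 hp) hc huv

theorem isSelfAdjoint_closure [CompleteSpace E] {S : E →ₗ.[ℂ] E} (hd : Dense (S.domain : Set E))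
    (hs : S.IsFormalAdjoint S) (h : S.adjoint.graph ≤ S.graph.topologicalClosure) :
    S.IsClosable ∧ IsSelfAdjoint S.closure := by
  have hle : S ≤ S.adjoint := hs.le_adjoint hd
  have hcl : S.IsClosable := (S.adjoint_isClosed hd).isClosable.leIsClosable hle
  refine ⟨hcl, LinearPMap.eq_of_eq_graph ?_⟩
  calc S.closure.adjoint.graph
      = S.graph.topologicalClosure.adjoint := by
        rw [LinearPMap.adjoint_graph_eq_graph_adjoint (hd.mono S.le_closure.1),
          hcl.graph_closure_eq_closure_graph]
    _ = S.adjoint.graph := by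
        rw [adjoint_topologicalClosure, LinearPMap.adjoint_graph_eq_graph_adjoint hd]
    _ = S.graph.topologicalClosure := h.antisymm <|
        S.graph.topologicalClosure_minimal (LinearPMap.le_graph_of_le hle) (S.adjoint_isClosed hd)
    _ = S.closure.graph := hcl.graph_closure_eq_closure_graph

variable {A : E →ₗ.[ℂ] E} {B C : E →L[ℂ] E}

theorem isCommutator_iff_forall_mem_graph :
    IsCommutator A B C ↔ ∀ p ∈ A.graph, ∀ q ∈ A.graph,
      ⟪p.2, B q.1⟫_ℂ - ⟪p.1, B q.2⟫_ℂ = ⟪p.1, C q.1⟫_ℂ := by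
  refine ⟨fun h p hp q hq => ?_, fun h x y => h _ (A.mem_graph x) _ (A.mem_graph y)⟩
  obtain ⟨x, hx₁, hx₂⟩ := (LinearPMap.mem_graph_iff A).1 hp
  obtain ⟨y, hy₁, hy₂⟩ := (LinearPMap.mem_graph_iff A).1 hq
  rw [← hx₁, ← hx₂, ← hy₁, ← hy₂]
  exact h x y

theorem IsCommutator.closure (h : IsCommutator A B C) (hA : A.IsClosable) :
    IsCommutator A.closure B C := by
  rw [isCommutator_iff_forall_mem_graph] at h ⊢
  rw [← hA.graph_closure_eq_closure_graph]
  intro p hp q hq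
  have hc : IsClosed {r : (E × E) × (E × E) |
      ⟪r.1.2, B r.2.1⟫_ℂ - ⟪r.1.1, B r.2.2⟫_ℂ = ⟪r.1.1, C r.2.1⟫_ℂ} :=
    isClosed_eq (by fun_prop) (by fun_prop)
  have hpq : (p, q) ∈ _root_.closure ((A.graph ×ˢ A.graph : Set (_ × _))) := by
    rw [closure_prod_eq]
    exact ⟨hp, hq⟩
  exact closure_minimal (fun r hr => h r.1 hr.1 r.2 hr.2) hc hpq

theorem isCommutator_of_span_eq_top {s : Set A.domain} (hs : Submodule.span ℂ s = ⊤)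
    (h : ∀ x ∈ s, ∀ y ∈ s, ⟪A x, B y⟫_ℂ - ⟪(x : E), B (A y)⟫_ℂ = ⟪(x : E), C y⟫_ℂ) :
    IsCommutator A B C := by
  intro x y
  have hx : x ∈ Submodule.span ℂ s := hs ▸ Submodule.mem_top
  have hy : y ∈ Submodule.span ℂ s := hs ▸ Submodule.mem_top
  induction hx, hy using Submodule.span_induction₂ with
  | mem_mem x y hx hy => exact h x hx y hy
  | zero_left _ _ => simp
  | zero_right _ _ => simp
  | add_left x y z hx hy hz h₁ h₂ =>
    simp only [LinearPMap.map_add, Submodule.coe_add, inner_add_left]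
    linear_combination h₁ + h₂
  | add_right x y z hx hy hz h₁ h₂ =>
    simp only [LinearPMap.map_add, Submodule.coe_add, map_add, inner_add_right]
    linear_combination h₁ + h₂
  | smul_left r x y hx hy h₁ =>
    simp only [LinearPMap.map_smul, Submodule.coe_smul, inner_smul_left]
    linear_combination conj r * h₁
  | smul_right r x y hx hy h₁ =>
    simp only [LinearPMap.map_smul, Submodule.coe_smul, map_smul, inner_smul_right]
    linear_combination r * h₁

end Unbounded

section Coordinates

open Filter Topology

theorem inner_e_left (k : ℤ) (u : EllTwo) : ⟪e k, u⟫_ℂ = u k := by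
  simp [e, lp.inner_single_left]

theorem e_apply (k j : ℤ) : e k j = if j = k then 1 else 0 := by
  simp [e, lp.single_apply, Pi.single_apply]

theorem hasSum_smul_e (u : EllTwo) : HasSum (fun k => u k • e k) u := by
  have h : ∀ k, lp.single (E := fun _ : ℤ => ℂ) 2 k (u k) = u k • e k := fun k => by
    rw [e, ← lp.single_smul, smul_eq_mul, mul_one]
  simpa only [h] using lp.hasSum_single (E := fun _ : ℤ => ℂ) (p := 2) (by simp) u

theorem clm_ext_e {A B : EllTwo →L[ℂ] EllTwo} (h : ∀ k, A (e k) = B (e k)) : A = B := by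
  ext1 u
  have hA := (hasSum_smul_e u).mapL A
  have hB := (hasSum_smul_e u).mapL B
  simp only [map_smul, h] at hA hB
  exact hA.unique hB

theorem dense_span_e : Dense (Submodule.span ℂ (Set.range e) : Set EllTwo) := fun u =>
  mem_closure_of_tendsto (hasSum_smul_e u) <| .of_forall fun _ =>
    Submodule.sum_mem _ fun k _ => Submodule.smul_mem _ _ (Submodule.subset_span ⟨k, rfl⟩)

theorem mem_span_e {u : EllTwo} (hu : {k | u k ≠ 0}.Finite) :
    u ∈ Submodule.span ℂ (Set.range e) := by
  have h : HasSum (fun k => u k • e k) (∑ k ∈ hu.toFinset, u k • e k) :=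
    hasSum_sum_of_ne_finset_zero fun k hk => by
      rw [not_not.1 (mt hu.mem_toFinset.2 hk), zero_smul]
  rw [(hasSum_smul_e u).unique h]
  exact Submodule.sum_mem _ fun k _ => Submodule.smul_mem _ _ (Submodule.subset_span ⟨k, rfl⟩)

theorem T_apply (u : EllTwo) (k : ℤ) : T u k = u (k - 1) := rfl

theorem T_e (k : ℤ) : T (e k) = e (k + 1) := by
  ext j
  simp only [T_apply, e_apply, sub_eq_iff_eq_add]

theorem adjoint_T_apply (u : EllTwo) (k : ℤ) :
    ContinuousLinearMap.adjoint T u k = u (k + 1) := by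
  rw [← inner_e_left, ContinuousLinearMap.adjoint_inner_right, T_e, inner_e_left]

theorem adjoint_T_e (k : ℤ) : ContinuousLinearMap.adjoint T (e k) = e (k - 1) := by
  ext j
  simp only [adjoint_T_apply, e_apply, eq_sub_iff_add_eq]

/-- The bounded operator `e_k ↦ t_k e_k`. -/
def diagonal {t : ℤ → ℝ} {C : ℝ} (ht : ∀ k, |t k| ≤ C) : EllTwo →L[ℂ] EllTwo :=
  lp.mapCLM 2 (fun k => (t k : ℂ) • ContinuousLinearMap.id ℂ ℂ) ((abs_nonneg _).trans (ht 0))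
    fun k => by simpa [norm_smul] using ht k

theorem diagonal_apply {t : ℤ → ℝ} {C : ℝ} (ht : ∀ k, |t k| ≤ C) (u : EllTwo) (k : ℤ) :
    diagonal ht u k = t k * u k := by
  simp [diagonal]

theorem sq_norm_eq_tsum (u : EllTwo) : ‖u‖ ^ 2 = ∑' k, ‖u k‖ ^ 2 := by
  simpa using lp.norm_rpow_eq_tsum (p := 2) (by norm_num) u

theorem summable_sq_norm (u : EllTwo) : Summable fun k => ‖u k‖ ^ 2 := by
  simpa using (lp.memℓp u).summable (by norm_num)

theorem tendsto_diagonal {t : ℕ → ℤ → ℝ} {C s : ℝ} (ht : ∀ n k, |t n k| ≤ C)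
    (hs : ∀ k, Tendsto (t · k) atTop (𝓝 s)) (u : EllTwo) :
    Tendsto (fun n => diagonal (ht n) u) atTop (𝓝 ((s : ℂ) • u)) := by
  have happ : ∀ n k, ‖(diagonal (ht n) u - (s : ℂ) • u) k‖ ^ 2 = (t n k - s) ^ 2 * ‖u k‖ ^ 2 := by
    intro n k
    rw [lp.coeFn_sub, lp.coeFn_smul, Pi.sub_apply, Pi.smul_apply, diagonal_apply, smul_eq_mul,
      ← sub_mul, ← Complex.ofReal_sub, norm_mul, Complex.norm_real, mul_pow, Real.norm_eq_abs,
      sq_abs]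
  have hsq : Tendsto (fun n => ‖diagonal (ht n) u - (s : ℂ) • u‖ ^ 2) atTop (𝓝 0) := by
    simp only [sq_norm_eq_tsum, happ]
    rw [← tsum_zero (α := ℝ) (β := ℤ)]
    refine tendsto_tsum_of_dominated_convergence ((summable_sq_norm u).mul_left ((C + |s|) ^ 2))
      (fun k => ?_) (.of_forall fun n k => ?_)
    · simpa using (((hs k).sub_const s).pow 2).mul_const (‖u k‖ ^ 2)
    · rw [Real.norm_of_nonneg (by positivity), ← sq_abs (t n k - s)]
      gcongr
      exact (abs_sub _ _).trans (add_le_add_left (ht n k) _)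
  rw [tendsto_iff_norm_sub_tendsto_zero]
  simpa using hsq.sqrt

end Coordinates

section Tent

open Filter Topology

/-- The piecewise linear cutoff of height one supported on `[-(n+1), n+1]`. -/
def tent (n : ℕ) (k : ℤ) : ℝ := max 0 (1 - |(k : ℝ)| / (n + 1))

theorem abs_tent_le_one (n : ℕ) (k : ℤ) : |tent n k| ≤ 1 := by
  have h : 0 ≤ |(k : ℝ)| / (n + 1) := by positivity
  rw [abs_of_nonneg (le_max_left _ _)]
  exact max_le zero_le_one (sub_le_self 1 h)

theorem tent_eq_zero {n : ℕ} {k : ℤ} (h : (n + 1 : ℝ) ≤ |(k : ℝ)|) : tent n k = 0 :=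
  max_eq_left <| sub_nonpos.2 <| (one_le_div (by positivity)).2 h

theorem finite_tent_ne_zero (n : ℕ) : {k | tent n k ≠ 0}.Finite := by
  refine (Set.finite_Icc (-(n + 1 : ℤ)) (n + 1)).subset fun k hk => ?_
  have h : |(k : ℝ)| < (n + 1 : ℝ) := not_le.1 (mt tent_eq_zero hk)
  rw [Set.mem_Icc, ← abs_le]
  exact_mod_cast h.le

theorem tendsto_tent (k : ℤ) : Tendsto (tent · k) atTop (𝓝 1) := by
  have h : Tendsto (fun n : ℕ => |(k : ℝ)| * (1 / ((n : ℝ) + 1))) atTop (𝓝 (|(k : ℝ)| * 0)) :=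
    tendsto_one_div_add_atTop_nhds_zero_nat.const_mul _
  simpa [tent, div_eq_mul_inv] using
    (tendsto_const_nhds (x := (0 : ℝ))).max ((tendsto_const_nhds (x := (1 : ℝ))).sub h)

theorem abs_tent_add_one_sub_le (n : ℕ) (k : ℤ) : |tent n (k + 1) - tent n k| ≤ 1 / (n + 1) := by
  have hn : (0 : ℝ) < n + 1 := by positivity
  refine (abs_max_sub_max_le_max _ _ _ _).trans (max_le ?_ ?_)
  · simpa using hn.le
  · rw [sub_sub_sub_cancel_left, ← sub_div, abs_div, abs_of_pos hn]
    gcongr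
    simpa using abs_abs_sub_abs_le_abs_sub (k : ℝ) ((k + 1 : ℤ) : ℝ)

/-- A tent has slope at most `1 / (n + 1)` and lives on `|k| ≤ n + 1`, so its increments beat
coefficients of linear growth. -/
theorem abs_mul_tent_add_one_sub_le {b : ℤ → ℝ} {C : ℝ} (hb : ∀ k, |b k| ≤ C * (1 + |(k : ℝ)|))
    (n : ℕ) (k : ℤ) : |b k * (tent n (k + 1) - tent n k)| ≤ 3 * C := by
  have hC : 0 ≤ C := by simpa using (abs_nonneg _).trans (hb 0)
  by_cases h : (n + 1 : ℝ) ≤ |(k : ℝ)| ∧ (n + 1 : ℝ) ≤ |((k + 1 : ℤ) : ℝ)|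
  · rw [tent_eq_zero h.1, tent_eq_zero h.2]
    simpa using hC
  · have hk : 1 + |(k : ℝ)| ≤ 3 * (n + 1) := by
      push_cast at h
      have : |(k : ℝ)| ≤ n + 2 := by
        rw [abs_le]
        rcases not_and_or.1 h with h | h <;> rw [not_le, abs_lt] at h <;> constructor <;> linarith
      linarith
    calc |b k * (tent n (k + 1) - tent n k)|
        ≤ C * (3 * (n + 1)) * (1 / (n + 1)) := by
          rw [abs_mul]
          gcongr
          exacts [(hb k).trans (by gcongr), abs_tent_add_one_sub_le n k]
      _ = 3 * C := by field_simp

end Tent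

/-- `S` is the Jacobi operator on the linear span of the `e_k` with weights `b_k` between `e_k`
and `e_{k+1}` and with diagonal entries `d_k`. -/
structure IsJacobi (b d : ℤ → ℝ) (S : EllTwo →ₗ.[ℂ] EllTwo) : Prop where
  domain_eq : S.domain = Submodule.span ℂ (Set.range e)
  apply_e : ∀ u : S.domain, ∀ k, (u : EllTwo) = e k →
    S u = (b k : ℂ) • e (k + 1) + (b (k - 1) : ℂ) • e (k - 1) + (d k : ℂ) • e k

namespace IsJacobi

open Filter Topology

variable {b d : ℤ → ℝ} {S : EllTwo →ₗ.[ℂ] EllTwo} (hS : IsJacobi b d S)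
include hS

theorem dense_domain : Dense (S.domain : Set EllTwo) := hS.domain_eq ▸ dense_span_e

theorem e_mem_domain (k : ℤ) : e k ∈ S.domain :=
  hS.domain_eq ▸ Submodule.subset_span ⟨k, rfl⟩

theorem isCommutator {B C : EllTwo →L[ℂ] EllTwo}
    (h : ∀ (j k : ℤ) (u v : S.domain), (u : EllTwo) = e j → (v : EllTwo) = e k →
      ⟪S u, B (e k)⟫_ℂ - ⟪e j, B (S v)⟫_ℂ = ⟪e j, C (e k)⟫_ℂ) :
    IsCommutator S B C := by
  have hspan : Submodule.span ℂ {u : S.domain | ∃ k, (u : EllTwo) = e k} = ⊤ := by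
    refine Submodule.map_injective_of_injective S.domain.injective_subtype ?_
    rw [Submodule.map_span, Submodule.map_top, Submodule.range_subtype, hS.domain_eq]
    congr 1
    ext u
    exact ⟨fun ⟨v, ⟨k, hk⟩, hv⟩ => ⟨k, hk.symm.trans hv⟩,
      fun ⟨k, hk⟩ => ⟨⟨u, Submodule.subset_span ⟨k, hk⟩⟩, ⟨k, hk.symm⟩, rfl⟩⟩
  refine isCommutator_of_span_eq_top hspan fun u ⟨j, hj⟩ v ⟨k, hk⟩ => ?_
  simpa only [hj, hk] using h j k u v hj hk

theorem inner_apply_e_left {u : S.domain} {k : ℤ} (hu : (u : EllTwo) = e k) (v : EllTwo) :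
    ⟪S u, v⟫_ℂ = b k * v (k + 1) + b (k - 1) * v (k - 1) + d k * v k := by
  simp only [hS.apply_e u k hu, inner_add_left, inner_smul_left, inner_e_left, Complex.conj_ofReal]

theorem isFormalAdjoint : S.IsFormalAdjoint S := by
  have h : IsCommutator S 1 0 := by
    refine hS.isCommutator fun j k u v hu hv => ?_
    simp only [one_apply_eq_self, zero_apply, inner_zero_right, hS.inner_apply_e_left hu,
      hS.apply_e v k hv, inner_add_right, inner_smul_right, inner_e_left, e_apply, sub_eq_zero]
    rcases eq_or_ne j k with rfl | h₀
    · simp [show j ≠ j - 1 by lia]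
    rcases eq_or_ne j (k + 1) with rfl | h₁
    · simp [show k + 1 + 1 ≠ k by lia, show k + 1 ≠ k - 1 by lia]
    rcases eq_or_ne j (k - 1) with rfl | h₂
    · simp [show k - 1 - 1 ≠ k by lia, show k - 1 ≠ k + 1 by lia]
    · simp [h₀, h₁, h₂, show j + 1 ≠ k by lia, show j - 1 ≠ k by lia]
  intro u v
  simpa [sub_eq_zero] using h u v

theorem apply_of_mem_adjoint_graph {v w : EllTwo} (h : (v, w) ∈ S.adjoint.graph) (k : ℤ) :
    w k = b k * v (k + 1) + b (k - 1) * v (k - 1) + d k * v k := by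
  rw [LinearPMap.adjoint_graph_eq_graph_adjoint hS.dense_domain, Submodule.mem_adjoint_iff] at h
  have hk := h _ _ (S.mem_graph ⟨e k, hS.e_mem_domain k⟩)
  rw [hS.inner_apply_e_left rfl, inner_e_left] at hk
  exact (sub_eq_zero.1 hk).symm

theorem apply (u : S.domain) (k : ℤ) :
    S u k = b k * (u : EllTwo) (k + 1) + b (k - 1) * (u : EllTwo) (k - 1) + d k * (u : EllTwo) k :=
  hS.apply_of_mem_adjoint_graph (LinearPMap.le_graph_of_le
    (hS.isFormalAdjoint.le_adjoint hS.dense_domain) (S.mem_graph u)) k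

theorem tent_mem_domain (n : ℕ) (v : EllTwo) : diagonal (abs_tent_le_one n) v ∈ S.domain := by
  rw [hS.domain_eq]
  refine mem_span_e ((finite_tent_ne_zero n).subset fun k hk hz => hk ?_)
  rw [diagonal_apply, hz, Complex.ofReal_zero, zero_mul]

variable {C : ℝ} (hb : ∀ k, |b k| ≤ C * (1 + |(k : ℝ)|))

theorem apply_tent {v w : EllTwo} (h : (v, w) ∈ S.adjoint.graph) (n : ℕ) :
    S ⟨_, hS.tent_mem_domain n v⟩ = diagonal (abs_tent_le_one n) w +
      diagonal (abs_mul_tent_add_one_sub_le hb n) (ContinuousLinearMap.adjoint T v) -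
      T (diagonal (abs_mul_tent_add_one_sub_le hb n) v) := by
  ext k
  simp only [hS.apply, lp.coeFn_sub, lp.coeFn_add, Pi.sub_apply, Pi.add_apply, T_apply,
    adjoint_T_apply, diagonal_apply, hS.apply_of_mem_adjoint_graph h, sub_add_cancel]
  push_cast
  ring

include hb in
/-- The commutator of `S` with a tent cutoff stays bounded and tends to zero strongly. -/
theorem tendsto_apply_tent {v w : EllTwo} (h : (v, w) ∈ S.adjoint.graph) :
    Tendsto (fun n => S ⟨_, hS.tent_mem_domain n v⟩) atTop (𝓝 w) := by
  have hr : ∀ k, Tendsto (fun n => b k * (tent n (k + 1) - tent n k)) atTop (𝓝 0) := fun k => by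
    simpa using ((tendsto_tent (k + 1)).sub (tendsto_tent k)).const_mul (b k)
  have hR := tendsto_diagonal (abs_mul_tent_add_one_sub_le hb) hr
  simp only [hS.apply_tent hb h]
  simpa using ((tendsto_diagonal abs_tent_le_one tendsto_tent w).add (hR _)).sub
    ((T.continuous.tendsto _).comp (hR v))

include hb in
theorem isClosable_and_isSelfAdjoint_closure : S.IsClosable ∧ IsSelfAdjoint S.closure := by
  refine isSelfAdjoint_closure hS.dense_domain hS.isFormalAdjoint ?_
  rintro ⟨v, w⟩ hvw
  have htent : Tendsto (fun n => diagonal (abs_tent_le_one n) v) atTop (𝓝 v) := by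
    simpa using tendsto_diagonal abs_tent_le_one tendsto_tent v
  exact mem_closure_of_tendsto (htent.prodMk_nhds (hS.tendsto_apply_tent hb hvw))
    (.of_forall fun n => S.mem_graph ⟨_, hS.tent_mem_domain n v⟩)

end IsJacobi

section ConjugateOperator

theorem intCast_mul_e_apply (k j : ℤ) : (j : ℂ) * e k j = k * e k j := by
  rw [e_apply]
  split_ifs with h <;> simp [h]

theorem e_mem_domain_position (k : ℤ) : e k ∈ position.domain := by
  have h : (fun j : ℤ => (j : ℂ) * e k j) = ((k : ℂ) • e k : EllTwo) :=
    funext (intCast_mul_e_apply k)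
  change Memℓp (fun j : ℤ => (j : ℂ) * e k j) 2
  exact h ▸ lp.memℓp _

theorem G_apply (a : ℝ) (u : EllTwo) (k : ℤ) :
    G a u k = a * u (k - 1) + a * u (k + 1) - 2 * u k := by
  rw [← adjoint_T_apply, ← T_apply]
  rfl

theorem G_e (a : ℝ) (k : ℤ) :
    G a (e k) = (a : ℂ) • e (k + 1) + (a : ℂ) • e (k - 1) - (2 : ℂ) • e k := by
  rw [← adjoint_T_e, ← T_e]
  rfl

theorem G_e_mem_domain_position (a : ℝ) (k : ℤ) : G a (e k) ∈ position.domain := by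
  rw [G_e]
  exact sub_mem (add_mem (Submodule.smul_mem _ _ (e_mem_domain_position _))
    (Submodule.smul_mem _ _ (e_mem_domain_position _)))
    (Submodule.smul_mem _ _ (e_mem_domain_position _))

theorem isJacobi_conjugateOpCore (a : ℝ) :
    IsJacobi (fun k => a * (2 * k + 1)) (fun k => -4 * k) (conjugateOpCore a) where
  domain_eq := inf_eq_left.2 <| Submodule.span_le.2 <| by
    rintro _ ⟨k, rfl⟩
    exact ⟨e_mem_domain_position k, G_e_mem_domain_position a k⟩
  apply_e := by
    rintro ⟨_, hu⟩ k rfl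
    have hcore : conjugateOpCore a ⟨e k, hu⟩ = G a (position ⟨e k, e_mem_domain_position k⟩) +
      position ⟨G a (e k), G_e_mem_domain_position a k⟩ := rfl
    have hpos : ∀ (v : position.domain) (j : ℤ), position v j = j * (v : EllTwo) j := fun _ _ => rfl
    have hpos_e : position ⟨e k, e_mem_domain_position k⟩ = (k : ℂ) • e k :=
      lp.ext (funext (intCast_mul_e_apply k))
    rw [hcore, hpos_e, map_smul]
    ext j
    simp only [G_e, lp.coeFn_sub, lp.coeFn_add, lp.coeFn_smul, Pi.sub_apply, Pi.add_apply,
      Pi.smul_apply, smul_eq_mul, hpos]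
    have h₁ := intCast_mul_e_apply (k + 1) j
    have h₂ := intCast_mul_e_apply (k - 1) j
    push_cast at h₁ h₂ ⊢
    linear_combination (a : ℂ) * h₁ + (a : ℂ) * h₂ - 2 * intCast_mul_e_apply k j

theorem isClosable_and_isSelfAdjoint_conjugateOp (a : ℝ) :
    (conjugateOpCore a).IsClosable ∧ IsSelfAdjoint (conjugateOp a) := by
  refine (isJacobi_conjugateOpCore a).isClosable_and_isSelfAdjoint_closure (C := |a| * 2)
    fun k => ?_
  rw [abs_mul, mul_assoc]
  gcongr
  calc |2 * (k : ℝ) + 1| ≤ |2 * (k : ℝ)| + |1| := abs_add_le _ _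
    _ ≤ 2 * (1 + |(k : ℝ)|) := by rw [abs_mul, abs_two, abs_one]; linarith

/-- Writing `D(m) = m c(m)` for the symbol of `L'`, the entry `(j, k)` of the commutator depends
on `m = j - k` alone and equals `2 (a D(m - 1) + a D(m + 1) - 2 D(m))`. -/
theorem isCommutator_conjugateOp (a : ℝ) {L L' : EllTwo →L[ℂ] EllTwo} {c : ℤ → ℂ}
    (hL : ∀ k j, L (e k) j = c (j - k)) (hL' : ∀ k j, L' (e k) j = (j - k : ℤ) * c (j - k)) :
    IsCommutator (conjugateOp a) L ((2 : ℂ) • (G a * L')) := by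
  have hS := isJacobi_conjugateOpCore a
  refine IsCommutator.closure (hS.isCommutator fun j k u v hu hv => ?_)
    (isClosable_and_isSelfAdjoint_conjugateOp a).1
  simp only [hS.inner_apply_e_left hu, hS.apply_e v k hv, map_add, map_smul, inner_add_right,
    inner_smul_right, inner_e_left, smul_apply, mul_apply_eq_comp, G_apply, hL, hL']
  rw [show j + 1 - k = j - k + 1 by ring, show j - 1 - k = j - k - 1 by ring,
    show j - (k + 1) = j - k - 1 by ring, show j - (k - 1) = j - k + 1 by ring]
  push_cast
  ring

end ConjugateOperator

section Fourier

open scoped CStarAlgebra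

/-- Continuous functions on a compact space, as essentially bounded functions. -/
def ofContinuousMap {X : Type*} [TopologicalSpace X] [CompactSpace X] [MeasurableSpace X]
    [OpensMeasurableSpace X] (μ : Measure X) : C(X, ℂ) →⋆ₐ[ℂ] essBounded μ where
  toFun f := ⟨f, memLp_top_of_bound
    (f.continuous.measurable.aestronglyMeasurable) ‖f‖ (.of_forall f.norm_coe_le_norm)⟩
  map_one' := rfl
  map_mul' _ _ := rfl
  map_zero' := rfl
  map_add' _ _ := rfl
  commutes' _ := rfl
  map_star' _ := rfl

/-- Fourier synthesis `ℓ²(ℤ) ≃ L²(ℝ / 2πℤ)`, with `e k ↦ e^{ikθ}`. -/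
def fourierEquiv : EllTwo ≃ₗᵢ[ℂ] Lp ℂ 2 (AddCircle.haarAddCircle (T := 2 * Real.pi)) :=
  fourierBasis.repr.symm

theorem fourierEquiv_e (k : ℤ) :
    fourierEquiv (e k) =ᵐ[AddCircle.haarAddCircle] (fourier k : C(Torus, ℂ)) := by
  have h : fourierEquiv (e k) = fourierLp 2 k := by
    rw [fourierEquiv, e, HilbertBasis.repr_symm_single, coe_fourierBasis]
  exact h ▸ coeFn_fourierLp 2 k

/-- The Laurent operator on `ℓ²(ℤ)` with continuous symbol `f`. -/
def laurent : C(Torus, ℂ) →⋆ₐ[ℂ] (EllTwo →L[ℂ] EllTwo) :=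
  (multiplier fourierEquiv).comp (ofContinuousMap AddCircle.haarAddCircle)

theorem fourierEquiv_laurent_e (f : C(Torus, ℂ)) (k : ℤ) :
    fourierEquiv (laurent f (e k)) =ᵐ[AddCircle.haarAddCircle]
      fun θ => f θ * (fourier k : C(Torus, ℂ)) θ := by
  filter_upwards [coeFn_multiplier fourierEquiv (ofContinuousMap _ f) (e k), fourierEquiv_e k]
    with θ h1 h2
  exact h1.trans (congrArg _ h2)

theorem laurent_e_apply (f : C(Torus, ℂ)) (k j : ℤ) :
    laurent f (e k) j = fourierCoeff f (j - k) := by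
  rw [← fourierEquiv.symm_apply_apply (laurent f (e k))]
  refine (fourierBasis_repr _ _).trans ?_
  rw [fourierCoeff_congr_ae (fourierEquiv_laurent_e f k)]
  refine integral_congr_ae (.of_forall fun θ => ?_)
  simp only [smul_eq_mul, neg_sub, sub_eq_add_neg k j, fourier_add]
  ring

theorem laurent_fourier_one : laurent (fourier 1) = T := by
  refine clm_ext_e fun k => ?_
  ext j
  rw [laurent_e_apply, T_e, e_apply, fourierCoeff_fourier, Pi.single_apply, eq_comm]
  simp only [sub_eq_iff_eq_add, add_comm 1 k]

theorem laurent_eq_cfc {F : ℂ → ℂ} (hF : ContinuousOn F (Metric.sphere 0 1)) {f : C(Torus, ℂ)}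
    (hf : ∀ θ : Torus, f θ = F (AddCircle.toCircle θ)) : laurent f = cfc F T := by
  have hs : spectrum ℂ (fourier 1 : C(Torus, ℂ)) ⊆ Metric.sphere 0 1 := by
    rw [ContinuousMap.spectrum_eq_range]
    rintro _ ⟨θ, rfl⟩
    simp [Circle.norm_coe]
  have h : f = cfc F (fourier 1 : C(Torus, ℂ)) := by
    ext θ
    let ev : C(Torus, ℂ) →⋆ₐ[ℂ] ℂ := ContinuousMap.evalStarAlgHom ℂ ℂ θ
    calc f θ = F (ev (fourier 1)) := by rw [hf, ← fourier_one]; rfl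
      _ = cfc F (ev (fourier 1)) := (cfc_algebraMap (A := ℂ) _ F).symm
      _ = ev (cfc F (fourier 1)) :=
        (ev.map_cfc F _ (hF.mono hs) (continuous_eval_const θ)).symm
  rw [h, laurent.map_cfc F _ (hF.mono hs) (map_continuous laurent), laurent_fourier_one]

theorem fourierCoeff_of_hasDerivAt {p : ℝ} [Fact (0 < p)] {f f' : C(AddCircle p, ℂ)}
    (hf : ∀ x : ℝ, HasDerivAt (fun y : ℝ => f y) (f' x) x) (n : ℤ) :
    fourierCoeff f' n = 2 * Real.pi * Complex.I * n / p * fourierCoeff f n := by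
  let c : ℂ := 2 * Real.pi * Complex.I * n / p
  have hint (g : C(AddCircle p, ℂ)) : IntervalIntegrable
      (fun x : ℝ => (fourier (-n) : C(AddCircle p, ℂ)) x * g x) volume 0 (0 + p) :=
    (((fourier (-n)).continuous.mul g.continuous).comp
      (AddCircle.continuous_mk' p)).intervalIntegrable _ _
  have hderiv (x : ℝ) : HasDerivAt (fun y : ℝ => (fourier (-n) : C(AddCircle p, ℂ)) y * f y)
      ((fourier (-n) : C(AddCircle p, ℂ)) x * f' x
        - c * ((fourier (-n) : C(AddCircle p, ℂ)) x * f x)) x := by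
    convert! (hasDerivAt_fourier_neg p n x).mul (hf x) using 1
    simp only [c]
    ring
  have h := intervalIntegral.integral_eq_sub_of_hasDerivAt (fun x _ => hderiv x)
    ((hint f').sub ((hint f).const_mul c))
  rw [intervalIntegral.integral_sub (hint f') ((hint f).const_mul c),
    intervalIntegral.integral_const_mul, zero_add, AddCircle.coe_period, AddCircle.coe_zero,
    sub_self, sub_eq_zero] at h
  simp only [fourierCoeff_eq_intervalIntegral _ n 0, smul_eq_mul, zero_add, h]
  exact mul_smul_comm _ _ _ |>.symm

end Fourier

section AbsoluteContinuity

open Filter Topology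

theorem quasiMeasurePreserving_of_hasStrictDerivAt {f f' : ℝ → ℝ}
    (hf : ∀ x, HasStrictDerivAt f (f' x) x) (hf' : ∀ᵐ x, f' x ≠ 0) :
    Measure.QuasiMeasurePreserving f := by
  have hfc : Continuous f := continuous_iff_continuousAt.2 fun x => (hf x).hasDerivAt.continuousAt
  refine ⟨hfc.measurable, Measure.AbsolutelyContinuous.mk fun N hN h0 => ?_⟩
  rw [Measure.map_apply hfc.measurable hN]
  suffices h : volume (f ⁻¹' N ∩ {x | f' x ≠ 0}) = 0 by
    refine measure_mono_null (fun x hx => ?_) (measure_union_null h (ae_iff.1 hf'))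
    exact (em (f' x ≠ 0)).imp (fun h => ⟨hx, h⟩) id
  refine measure_null_of_locally_null _ fun x hx => ?_
  let ψ := ((hf x).hasStrictFDerivAt_equiv hx.2).toOpenPartialHomeomorph f
  let t := {y ∈ ψ.target ∩ N | f' (ψ.symm y) ≠ 0}
  have hψ : DifferentiableOn ℝ ψ.symm t := fun y hy =>
    (ψ.hasDerivAt_symm hy.1.1 hy.2 (hf _).hasDerivAt).differentiableAt.differentiableWithinAt
  refine ⟨ψ.symm '' t, mem_of_superset (inter_mem_nhdsWithin _ (ψ.open_source.mem_nhds
    ((hf x).hasStrictFDerivAt_equiv hx.2).mem_toOpenPartialHomeomorph_source)) ?_,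
    addHaar_image_eq_zero_of_differentiableOn_of_addHaar_eq_zero volume hψ
      (measure_mono_null (fun y hy => hy.1.2) h0)⟩
  rintro y ⟨⟨hyN, hy'⟩, hy⟩
  have hy' : f' (ψ.symm (ψ y)) ≠ 0 := by rwa [ψ.left_inv hy]
  exact ⟨ψ y, ⟨⟨ψ.map_source hy, hyN⟩, hy'⟩, ψ.left_inv hy⟩

variable {p : ℝ} [hp : Fact (0 < p)]

theorem quasiMeasurePreserving_coe_addCircle :
    Measure.QuasiMeasurePreserving ((↑) : ℝ → AddCircle p) := by
  refine ⟨AddCircle.measurable_mk', Measure.AbsolutelyContinuous.mk fun N hN h0 => ?_⟩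
  rw [Measure.map_apply AddCircle.measurable_mk' hN]
  refine measure_null_of_locally_null _ fun x _ =>
    ⟨_ ∩ Set.Ioc (x - p / 2) (x - p / 2 + p), inter_mem_nhdsWithin _ (Ioc_mem_nhds ?_ ?_), ?_⟩
  · linarith [hp.out]
  · linarith [hp.out]
  · rw [← Measure.restrict_apply' measurableSet_Ioc]
    exact ((AddCircle.measurePreserving_mk p _).measure_preimage hN.nullMeasurableSet).trans h0

theorem quasiMeasurePreserving_of_lift {φ : C(AddCircle p, ℝ)} {φ' : AddCircle p → ℝ}
    (hφ : ∀ x : ℝ, HasStrictDerivAt (fun y : ℝ => φ y) (φ' x) x) (hφ' : ∀ᵐ θ, φ' θ ≠ 0) :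
    Measure.QuasiMeasurePreserving (fun θ => (φ θ : AddCircle p)) := by
  have hmk := quasiMeasurePreserving_coe_addCircle (p := p)
  have h := (hmk.comp (quasiMeasurePreserving_of_hasStrictDerivAt hφ (hmk.ae hφ'))).mono_left
    (Measure.restrict_le_self (s := Set.Ioc 0 (0 + p))).absolutelyContinuous
  have hm' : Measurable fun θ => (φ θ : AddCircle p) :=
    AddCircle.measurable_mk'.comp φ.continuous.measurable
  refine ⟨hm', ?_⟩
  rw [← (AddCircle.measurePreserving_mk p 0).map_eq,
    Measure.map_map hm' AddCircle.measurable_mk', (AddCircle.measurePreserving_mk p 0).map_eq]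
  exact h.absolutelyContinuous

end AbsoluteContinuity

section ConjugationDefect

/-- The symbol `a z + a z⁻¹ - 2` of the Laurent operator `G a`. -/
def symbolG (a : ℝ) : C(Torus, ℂ) :=
  (a : ℂ) • fourier 1 + (a : ℂ) • star (fourier 1) - (2 : ℂ) • 1

theorem laurent_symbolG (a : ℝ) : laurent (symbolG a) = G a := by
  simp only [symbolG, map_sub, map_add, map_smul, map_star, map_one, laurent_fourier_one]
  rfl

theorem symbolG_apply (a : ℝ) (θ : Torus) :
    symbolG a θ = (2 * (a * (AddCircle.toCircle θ : ℂ).re - 1) : ℝ) := by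
  have h := Complex.add_conj (AddCircle.toCircle θ : ℂ)
  simp only [symbolG, ContinuousMap.sub_apply, ContinuousMap.add_apply, ContinuousMap.smul_apply,
    ContinuousMap.star_apply, ContinuousMap.one_apply, fourier_one, smul_eq_mul, ← mul_add,
    RCLike.star_def, h]
  push_cast
  ring

/-- With `f = e^{iφ}` and `g = φ'`, the commutator of `conjugateOp a` and `f` has symbol
`2 (symbolG a) g f`, and multiplication by `conj f` removes the factor `f`. -/
theorem isConjugationDefect_laurent (a : ℝ) {f g : C(Torus, ℂ)} (hf : f ∈ unitary C(Torus, ℂ))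
    (hfg : ∀ x : ℝ, HasDerivAt (fun y : ℝ => f y) (Complex.I * (g x * f x)) x) :
    IsConjugationDefect (conjugateOp a) (laurent f) (laurent ((2 : ℂ) • (symbolG a * g))) := by
  have hcoeff (n : ℤ) : fourierCoeff (g * f) n = n * fourierCoeff f n := by
    have h := fourierCoeff_of_hasDerivAt (f' := Complex.I • (g * f)) hfg n
    rw [ContinuousMap.coe_smul, fourierCoeff.const_smul, smul_eq_mul] at h
    have hπ : (Real.pi : ℂ) ≠ 0 := Complex.ofReal_ne_zero.2 Real.pi_ne_zero
    refine mul_left_cancel₀ Complex.I_ne_zero (h.trans ?_)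
    push_cast
    field_simp
  refine ⟨(isClosable_and_isSelfAdjoint_conjugateOp a).2, Unitary.map_mem laurent hf, _,
    isCommutator_conjugateOp a (laurent_e_apply f)
      (fun k j => (laurent_e_apply (g * f) k j).trans (hcoeff _)), ?_⟩
  rw [← laurent_symbolG, ← ContinuousLinearMap.star_eq_adjoint, ← ContinuousLinearMap.mul_def,
    ← map_star, ← map_mul, ← map_smul, ← map_mul]
  congr 1
  calc (2 : ℂ) • (symbolG a * g) = (2 : ℂ) • (star f * f * (symbolG a * g)) := by
        rw [Unitary.star_mul_self_of_mem hf, one_mul]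
    _ = star f * (2 : ℂ) • (symbolG a * (g * f)) := by
        rw [mul_smul_comm]
        ring_nf

theorem coe_toCircle_coe (x : ℝ) :
    (AddCircle.toCircle (x : Torus) : ℂ) = Complex.exp (x * Complex.I) := by
  rw [AddCircle.toCircle_apply_mk, div_self Real.two_pi_pos.ne', one_mul, Circle.coe_exp]

theorem measurable_coe_torus (φ : C(Torus, ℝ)) : Measurable fun θ => (φ θ : Torus) :=
  AddCircle.measurable_mk'.comp φ.continuous.measurable

/-- The function `e^{iφ}`. -/
def expPhaseMap (φ : C(Torus, ℝ)) : C(Torus, ℂ) where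
  toFun θ := AddCircle.toCircle (φ θ : Torus)
  continuous_toFun :=
    continuous_coe_toCircle.comp ((AddCircle.continuous_mk' _).comp φ.continuous)

theorem expPhaseMap_mem_unitary (φ : C(Torus, ℝ)) : expPhaseMap φ ∈ unitary C(Torus, ℂ) := by
  refine Unitary.mem_iff_self_mul_star.2 (ContinuousMap.ext fun θ => ?_)
  exact (Complex.mul_conj' _).trans (by simp [expPhaseMap, Circle.norm_coe])

theorem phaseOperator_eq_laurent (φ : C(Torus, ℝ)) :
    phaseOperator (measurable_coe_torus φ) fourierEquiv = laurent (expPhaseMap φ) :=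
  congrArg (multiplier fourierEquiv) (Subtype.ext rfl)

theorem isConjugationDefect_phaseOperator (a : ℝ) {φ φ' : C(Torus, ℝ)}
    (hφ : ∀ x : ℝ, HasDerivAt (fun y : ℝ => φ y) (φ' x) x) :
    IsConjugationDefect (conjugateOp a) (phaseOperator (measurable_coe_torus φ) fourierEquiv)
      (laurent ((2 : ℂ) • (symbolG a * φ'.realToRCLike ℂ))) := by
  rw [phaseOperator_eq_laurent]
  refine isConjugationDefect_laurent a (expPhaseMap_mem_unitary φ) fun x => ?_
  have h := ((hφ x).ofReal_comp.mul_const Complex.I).cexp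
  simp only [expPhaseMap, ContinuousMap.coe_mk, coe_toCircle_coe]
  refine h.congr_deriv ?_
  rw [ContinuousMap.realToRCLike_apply]
  simp only [Complex.coe_algebraMap]
  ring

end ConjugationDefect

section Phase

theorem exp_two_mul_arctan_im_div_re {w : ℂ} (hw : w.re ≠ 0) :
    Complex.exp (2 * Real.arctan (w.im / w.re) * Complex.I) = w / conj w := by
  let t := Real.arctan (w.im / w.re)
  have ht : Real.cos t ≠ 0 := (Real.cos_arctan_pos _).ne'
  have hr : w.re / Real.cos t ≠ 0 := div_ne_zero hw ht
  have h : w = (w.re / Real.cos t : ℝ) * Complex.exp (t * Complex.I) := by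
    refine Complex.ext ?_ ?_
    · rw [Complex.re_ofReal_mul, Complex.exp_ofReal_mul_I_re, div_mul_cancel₀ _ ht]
    · rw [Complex.im_ofReal_mul, Complex.exp_ofReal_mul_I_im, div_mul_eq_mul_div, mul_div_assoc,
        ← Real.tan_eq_sin_div_cos, Real.tan_arctan, mul_div_cancel₀ _ hw]
  calc Complex.exp (2 * t * Complex.I)
      = Complex.exp (t * Complex.I) / conj (Complex.exp (t * Complex.I)) := by
        rw [← Complex.exp_conj, ← Complex.exp_sub, map_mul, Complex.conj_ofReal, Complex.conj_I]
        congr 1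
        ring
    _ = w / conj w := by
        conv_rhs => rw [h, map_mul, Complex.conj_ofReal,
          mul_div_mul_left _ _ (Complex.ofReal_ne_zero.2 hr)]

theorem sub_re_ne_zero {a : ℝ} (ha : 1 < |a|) {z : ℂ} (hz : ‖z‖ = 1) : a - z.re ≠ 0 :=
  fun h => (ha.trans_eq (congrArg _ (sub_eq_zero.1 h))).not_ge (hz ▸ Complex.abs_re_le_norm z)

theorem ofReal_sub_ne_zero {a : ℝ} (ha : 1 < |a|) {z : ℂ} (hz : ‖z‖ = 1) : (a : ℂ) - z ≠ 0 :=
  fun h => sub_re_ne_zero ha hz (by simpa using congrArg Complex.re h)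

theorem symbol_of_norm_eq_one (a : ℝ) {z : ℂ} (hz : ‖z‖ = 1) :
    symbol a z = -((a - conj z) / (a - z)) := by
  have hz0 : z ≠ 0 := norm_ne_zero_iff.1 (hz.symm ▸ one_ne_zero)
  have h : 1 - a * z = z * (conj z - a) := by
    rw [mul_sub, Complex.mul_conj', hz]
    push_cast
    ring
  rw [symbol, h, mul_div_mul_left _ _ hz0, ← neg_div, neg_sub]

/-- The argument of `F_a(e^{iθ}) = -w / conj w`, `w = a - e^{-iθ}`, as a real function on the
torus; it exists globally because `re w` never vanishes, so `F_a` has winding number zero. -/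
def phase {a : ℝ} (ha : 1 < |a|) : C(Torus, ℝ) where
  toFun θ := Real.pi + 2 * Real.arctan
    ((AddCircle.toCircle θ : ℂ).im / (a - (AddCircle.toCircle θ : ℂ).re))
  continuous_toFun := continuous_const.add <| continuous_const.mul <|
    Real.continuous_arctan.comp <| (Complex.continuous_im.comp continuous_coe_toCircle).div
      (continuous_const.sub (Complex.continuous_re.comp continuous_coe_toCircle))
      fun _ => sub_re_ne_zero ha (Circle.norm_coe _)

/-- The derivative of `phase`. -/
def phaseDeriv {a : ℝ} (ha : 1 < |a|) : C(Torus, ℝ) where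
  toFun θ := 2 * (a * (AddCircle.toCircle θ : ℂ).re - 1) /
    Complex.normSq (a - AddCircle.toCircle θ)
  continuous_toFun := Continuous.div
    (continuous_const.mul ((continuous_const.mul
      (Complex.continuous_re.comp continuous_coe_toCircle)).sub continuous_const))
    (Complex.continuous_normSq.comp (continuous_const.sub continuous_coe_toCircle))
    fun _ => Complex.normSq_eq_zero.not.2 (ofReal_sub_ne_zero ha (Circle.norm_coe _))

variable {a : ℝ} (ha : 1 < |a|)

theorem toCircle_phase (θ : Torus) :
    (AddCircle.toCircle (phase ha θ : Torus) : ℂ) = symbol a (AddCircle.toCircle θ) := by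
  have hz := Circle.norm_coe (AddCircle.toCircle θ)
  have hw : ((a : ℂ) - conj (AddCircle.toCircle θ : ℂ)).re ≠ 0 := by
    simpa using sub_re_ne_zero ha hz
  have h := exp_two_mul_arctan_im_div_re hw
  simp only [Complex.sub_re, Complex.sub_im, Complex.conj_re, Complex.conj_im, Complex.ofReal_re,
    Complex.ofReal_im, zero_sub, neg_neg, map_sub, Complex.conj_ofReal, Complex.conj_conj] at h
  rw [symbol_of_norm_eq_one a hz, ← h, coe_toCircle_coe, ← neg_one_mul, ← Complex.exp_pi_mul_I,
    ← Complex.exp_add, ← add_mul]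
  simp only [phase, ContinuousMap.coe_mk]
  push_cast
  rfl

theorem hasStrictDerivAt_phase (x : ℝ) :
    HasStrictDerivAt (fun y : ℝ => phase ha y) (phaseDeriv ha x) x := by
  have hz := Circle.norm_coe (AddCircle.toCircle (x : Torus))
  have h0 := sub_re_ne_zero ha hz
  have h1 := Complex.normSq_eq_zero.not.2 (ofReal_sub_ne_zero ha hz)
  simp only [phase, phaseDeriv, ContinuousMap.coe_mk, coe_toCircle_coe,
    Complex.exp_ofReal_mul_I_re, Complex.exp_ofReal_mul_I_im, Complex.normSq_apply, Complex.sub_re,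
    Complex.sub_im, Complex.ofReal_re, Complex.ofReal_im] at h0 h1 ⊢
  refine (((((Real.hasStrictDerivAt_sin x).fun_div
    ((Real.hasStrictDerivAt_cos x).const_sub a) h0).arctan).const_mul 2).const_add
      Real.pi).congr_deriv ?_
  have h2 : 1 + (Real.sin x / (a - Real.cos x)) ^ 2 =
      ((a - Real.cos x) * (a - Real.cos x) + (0 - Real.sin x) * (0 - Real.sin x)) /
        (a - Real.cos x) ^ 2 := by
    field_simp
    ring
  rw [h2]
  field_simp
  linear_combination (-1 : ℝ) * Real.sin_sq_add_cos_sq x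

end Phase

section ConstGGT

theorem T_pow_e (n : ℕ) (k : ℤ) : (T ^ n) (e k) = e (k + n) := by
  induction n with
  | zero => simp
  | succ n ih =>
    rw [pow_succ', mul_apply_eq_comp, ih, T_e, Nat.cast_succ, add_assoc]

open scoped CStarAlgebra

theorem norm_inv_smul_fourier_one_lt_one {a : ℝ} (ha : 1 < |a|) :
    ‖(a : ℂ)⁻¹ • (fourier 1 : C(Torus, ℂ))‖ < 1 := by
  rw [norm_smul, fourier_norm, mul_one, norm_inv, Complex.norm_real]
  exact inv_lt_one_of_one_lt₀ ha

variable {a : ℝ} (ha : 1 < |a|)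
include ha

theorem hasSum_laurent_geometric :
    HasSum (fun j : ℕ => ((a : ℂ)⁻¹ • T) ^ j)
      (laurent (∑' j : ℕ, ((a : ℂ)⁻¹ • fourier 1) ^ j)) := by
  have h := (summable_geometric_of_norm_lt_one (norm_inv_smul_fourier_one_lt_one ha)).hasSum
  simpa only [Function.comp_def, map_pow, map_smul, laurent_fourier_one] using
    h.map laurent (map_continuous laurent)

theorem symbol_eq {α : ℂ} (h : ‖α‖ ^ 2 + (a ^ 2)⁻¹ = 1) {z : ℂ} (hz : ‖z‖ = 1) :
    symbol a z = (a : ℂ)⁻¹ * conj z - ((‖α‖ ^ 2 : ℝ) : ℂ) * (1 - (a : ℂ)⁻¹ * z)⁻¹ := by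
  have h1 : ‖α‖ ^ 2 = 1 - (a ^ 2)⁻¹ := eq_sub_of_add_eq h
  have h2 := ofReal_sub_ne_zero ha hz
  have h3 : (a : ℂ) ≠ 0 := Complex.ofReal_ne_zero.2 (abs_pos.1 (one_pos.trans ha))
  have h4 : 1 - (a : ℂ)⁻¹ * z = (a - z) / a := by field_simp
  have h5 : z * conj z = 1 := by simp [Complex.mul_conj', hz]
  rw [h1, symbol_of_norm_eq_one a hz, h4]
  push_cast
  field_simp
  linear_combination h5

theorem constGGT_eq_laurent {α : ℂ} (h : ‖α‖ ^ 2 + (a ^ 2)⁻¹ = 1) {f : C(Torus, ℂ)}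
    (hf : ∀ θ, f θ = symbol a (AddCircle.toCircle θ)) : constGGT α a = laurent f := by
  let S : C(Torus, ℂ) := ∑' j : ℕ, ((a : ℂ)⁻¹ • fourier 1) ^ j
  have hS : (1 - (a : ℂ)⁻¹ • fourier 1) * S = 1 :=
    mul_neg_geom_series _ (norm_inv_smul_fourier_one_lt_one ha)
  have hfS : f = (a : ℂ)⁻¹ • star (fourier 1) - ((‖α‖ ^ 2 : ℝ) : ℂ) • S := by
    ext θ
    have hSθ : (1 - (a : ℂ)⁻¹ * AddCircle.toCircle θ) * S θ = 1 := by
      simpa using congrArg (fun g : C(Torus, ℂ) => g θ) hS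
    rw [hf, symbol_eq ha h (Circle.norm_coe _), ← eq_inv_of_mul_eq_one_right hSθ]
    simp
  rw [hfS, map_sub, map_smul, map_smul, map_star, laurent_fourier_one, constGGT,
    (hasSum_laurent_geometric ha).tsum_eq]
  rfl

theorem constGGT_eq_phaseOperator {α : ℂ} (h : ‖α‖ ^ 2 + (a ^ 2)⁻¹ = 1) :
    constGGT α a = phaseOperator (measurable_coe_torus (phase ha)) fourierEquiv := by
  rw [phaseOperator_eq_laurent]
  exact constGGT_eq_laurent ha h (toCircle_phase ha)

theorem continuousOn_symbol : ContinuousOn (symbol a) (Metric.sphere 0 1) := by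
  refine ContinuousOn.div (by fun_prop) (by fun_prop) fun z hz => ?_
  have hz1 : ‖z‖ = 1 := mem_sphere_zero_iff_norm.1 hz
  exact mul_ne_zero (norm_ne_zero_iff.1 (hz1.symm ▸ one_ne_zero)) (ofReal_sub_ne_zero ha hz1)

theorem constGGT_eq_cfc {α : ℂ} (h : ‖α‖ ^ 2 + (a ^ 2)⁻¹ = 1) :
    constGGT α a = cfc (symbol a) T := by
  let f : C(Torus, ℂ) := ⟨fun θ => symbol a (AddCircle.toCircle θ),
    (continuousOn_symbol ha).comp_continuous continuous_coe_toCircle fun θ =>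
      mem_sphere_zero_iff_norm.2 (Circle.norm_coe _)⟩
  rw [constGGT_eq_laurent ha h (f := f) fun _ => rfl]
  exact laurent_eq_cfc (continuousOn_symbol ha) fun _ => rfl

theorem isGGTRepresentation_constGGT {α : ℂ} (h : ‖α‖ ^ 2 + (a ^ 2)⁻¹ = 1) :
    IsGGTRepresentation (fun _ => α) (fun _ => a) (constGGT α a) := by
  refine ⟨fun _ => h, fun k => ⟨α • (∑' j : ℕ, ((a : ℂ)⁻¹ • T) ^ j) (e k), ?_, ?_⟩⟩
  · have hsum := (hasSum_laurent_geometric ha).summable.hasSum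
    convert! (hsum.mapL (ContinuousLinearMap.apply ℂ EllTwo (e k))).const_smul α using 2 with n
    simp only [ContinuousLinearMap.apply_apply, smul_pow, smul_apply, T_pow_e, smul_smul,
      Finset.prod_const, Int.card_Ioc, add_sub_cancel_left, Int.toNat_natCast]
  · rw [smul_smul, Complex.conj_mul']
    simp [constGGT, adjoint_T_e]

end ConstGGT

section Propagation

variable {a : ℝ} (ha : 1 < |a|)

/-- The symbol of the defect: both factors of `2 (symbolG a) φ'`, where `φ = phase ha`, are
multiples of `φ'`. -/
def defectSymbol : C(Torus, ℝ) where
  toFun θ := 2 * Complex.normSq (a - AddCircle.toCircle θ) * phaseDeriv ha θ ^ 2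
  continuous_toFun := (continuous_const.mul (Complex.continuous_normSq.comp
    (continuous_const.sub continuous_coe_toCircle))).mul ((phaseDeriv ha).continuous.pow 2)

theorem symbolG_mul_phaseDeriv_apply (θ : Torus) :
    ((2 : ℂ) • (symbolG a * (phaseDeriv ha).realToRCLike ℂ)) θ = (defectSymbol ha θ : ℂ) := by
  have h := Complex.normSq_eq_zero.not.2 (ofReal_sub_ne_zero ha
    (Circle.norm_coe (AddCircle.toCircle θ)))
  have hG : 2 * (a * (AddCircle.toCircle θ : ℂ).re - 1) =
      Complex.normSq (a - AddCircle.toCircle θ) * phaseDeriv ha θ :=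
    (mul_div_cancel₀ _ h).symm
  rw [ContinuousMap.smul_apply, ContinuousMap.mul_apply, symbolG_apply, hG,
    ContinuousMap.realToRCLike_apply]
  simp only [defectSymbol, ContinuousMap.coe_mk, smul_eq_mul, Complex.coe_algebraMap]
  push_cast
  ring

theorem defectSymbol_nonneg (θ : Torus) : 0 ≤ defectSymbol ha θ :=
  mul_nonneg (mul_nonneg zero_le_two (Complex.normSq_nonneg _)) (sq_nonneg _)

theorem defectSymbol_eq_zero_iff (θ : Torus) : defectSymbol ha θ = 0 ↔ phaseDeriv ha θ = 0 := by
  have h := Complex.normSq_eq_zero.not.2 (ofReal_sub_ne_zero ha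
    (Circle.norm_coe (AddCircle.toCircle θ)))
  exact (mul_eq_zero_iff_left (mul_ne_zero two_ne_zero h)).trans sq_eq_zero_iff

theorem eq_arccos_or_eq_neg_arccos_of_phaseDeriv_eq_zero {θ : Torus} (h : phaseDeriv ha θ = 0) :
    θ = (Real.arccos a⁻¹ : Torus) ∨ θ = ((-Real.arccos a⁻¹ : ℝ) : Torus) := by
  obtain ⟨x, rfl⟩ := QuotientAddGroup.mk_surjective θ
  have hn := Complex.normSq_eq_zero.not.2 (ofReal_sub_ne_zero ha
    (Circle.norm_coe (AddCircle.toCircle (x : Torus))))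
  have hx : (AddCircle.toCircle (x : Torus) : ℂ).re = a⁻¹ := by
    have := (div_eq_zero_iff.1 h).resolve_right hn
    exact eq_inv_of_mul_eq_one_right (by linarith)
  rw [coe_toCircle_coe, Complex.exp_ofReal_mul_I_re] at hx
  refine Real.Angle.cos_eq_iff_coe_eq_or_eq_neg.1 ?_
  rw [← hx, Real.cos_arccos (Real.neg_one_le_cos x) (Real.cos_le_one x)]

theorem ae_phaseDeriv_ne_zero : ∀ᵐ θ, phaseDeriv ha θ ≠ 0 := by
  have : NullSingletonClass (volume : Measure Torus) := ⟨fun θ => by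
    rw [← Metric.closedBall_zero, AddCircle.volume_closedBall]
    simp⟩
  let S : Set Torus := {(Real.arccos a⁻¹ : Torus), ((-Real.arccos a⁻¹ : ℝ) : Torus)}
  have hS : volume S = 0 := S.toFinite.measure_zero volume
  filter_upwards [measure_eq_zero_iff_ae_notMem.1 hS] with θ hθ h0
  exact hθ (eq_arccos_or_eq_neg_arccos_of_phaseDeriv_eq_zero ha h0)

theorem haarAddCircle_absolutelyContinuous_volume :
    (AddCircle.haarAddCircle : Measure Torus) ≪ volume := by
  rw [AddCircle.volume_eq_smul_haarAddCircle]
  exact Measure.absolutelyContinuous_smul (by simp [Real.pi_pos])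

theorem toCircle_argPos {z : ℂ} (hz : ‖z‖ = 1) :
    (AddCircle.toCircle (argPos z : Torus) : ℂ) = z := by
  have h : (argPos z : Torus) = (z.arg : Torus) := by
    rw [argPos, toIcoMod, AddCircle.coe_sub, AddCircle.coe_zsmul, AddCircle.coe_period, smul_zero,
      sub_zero]
  have hz' := Complex.norm_mul_exp_arg_mul_I z
  rwa [hz, Complex.ofReal_one, one_mul, ← coe_toCircle_coe, ← h] at hz'

theorem coe_phase (x : ℝ) : (phase ha x : Torus) = (argPos (circleSymbol a x) : Torus) := by
  have h : (AddCircle.toCircle (phase ha x : Torus) : ℂ) = circleSymbol a x := by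
    rw [toCircle_phase, circleSymbol, coe_toCircle_coe, Circle.coe_exp]
  refine AddCircle.injective_toCircle Real.two_pi_pos.ne' (Circle.ext ?_)
  rw [toCircle_argPos (h ▸ Circle.norm_coe _), h]

variable {α : ℂ} (h : ‖α‖ ^ 2 + (a ^ 2)⁻¹ = 1)
include h

theorem isConjugationDefect_constGGT :
    IsConjugationDefect (conjugateOp a) (constGGT α a)
      (laurent ((2 : ℂ) • (symbolG a * (phaseDeriv ha).realToRCLike ℂ))) := by
  rw [constGGT_eq_phaseOperator ha h]
  exact isConjugationDefect_phaseOperator a fun x => (hasStrictDerivAt_phase ha x).hasDerivAt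

include ha

theorem isWeaklyPropagating_constGGT : IsWeaklyPropagating (constGGT α a) (conjugateOp a) := by
  have hA := isConjugationDefect_constGGT ha h
  rw [constGGT_eq_phaseOperator ha h] at hA ⊢
  refine isWeaklyPropagating_phaseOperator hA (symbolG_mul_phaseDeriv_apply ha)
    (defectSymbol_nonneg ha) ?_
  filter_upwards [haarAddCircle_absolutelyContinuous_volume (ae_phaseDeriv_ne_zero ha)] with θ
  exact (defectSymbol_eq_zero_iff ha θ).not.2

theorem isStrictlyPropagatingOn_constGGT {Θ : Set Torus} (hΘ : MeasurableSet Θ)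
    (hl : (arcLower a : Torus) ∉ closure Θ) (hu : (arcUpper a : Torus) ∉ closure Θ) :
    IsStrictlyPropagatingOn (constGGT α a) (conjugateOp a) Θ := by
  have hφ : Continuous fun θ => (phase ha θ : Torus) :=
    (AddCircle.continuous_mk' _).comp (phase ha).continuous
  have hpos : ∀ θ ∈ (fun θ => (phase ha θ : Torus)) ⁻¹' closure Θ, 0 < defectSymbol ha θ := by
    refine fun θ hθ => (defectSymbol_nonneg ha θ).lt_of_ne' fun h0 => ?_
    rcases eq_arccos_or_eq_neg_arccos_of_phaseDeriv_eq_zero ha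
      ((defectSymbol_eq_zero_iff ha θ).1 h0) with rfl | rfl
    · exact hu (coe_phase ha (Real.arccos a⁻¹) ▸ hθ)
    · exact hl (coe_phase ha (-Real.arccos a⁻¹) ▸ hθ)
  obtain ⟨c, hc, hcδ⟩ := (isClosed_closure.preimage hφ).isCompact.exists_forall_le'
    (defectSymbol ha).continuous.continuousOn hpos
  have hA := isConjugationDefect_constGGT ha h
  rw [constGGT_eq_phaseOperator ha h] at hA ⊢
  exact isStrictlyPropagatingOn_phaseOperator hA (symbolG_mul_phaseDeriv_apply ha) hΘ hc
    fun θ hθ => hcδ θ (subset_closure hθ)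

theorem hasPurelyACSpectrum_constGGT : HasPurelyACSpectrum (constGGT α a) := by
  rw [constGGT_eq_phaseOperator ha h]
  exact hasPurelyACSpectrum_phaseOperator ((quasiMeasurePreserving_of_lift
    (hasStrictDerivAt_phase ha) (ae_phaseDeriv_ne_zero ha)).mono_left
      haarAddCircle_absolutelyContinuous_volume)

end Propagation

theorem IsArc.measurableSet {Θ : Set Torus} (h : IsArc Θ) : MeasurableSet Θ := by
  obtain ⟨I, hI, rfl⟩ := h
  have h1 : I = ⋃ n : ℤ, I ∩ Set.Ico (n • (2 * Real.pi)) ((n + 1) • (2 * Real.pi)) := by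
    rw [← Set.inter_iUnion, iUnion_Ico_zsmul Real.two_pi_pos, Set.inter_univ]
  rw [h1, Set.image_iUnion]
  refine MeasurableSet.iUnion fun n => MeasurableSet.image_of_continuousOn_injOn
    (hI.measurableSet.inter measurableSet_Ico) (AddCircle.continuous_mk' _).continuousOn ?_
  refine fun x hx y hy hxy =>
    (AddCircle.coe_eq_coe_iff_of_mem_Ico (a := n • (2 * Real.pi)) ?_ ?_).1 hxy
  · simpa [add_smul] using hx.2
  · simpa [add_smul] using hy.2

end GGT

end

theorem proposition5p2_general (α : ℂ) (a : ℝ) (ha : 1 < |a|) (h : ‖α‖ ^ 2 + (a ^ 2)⁻¹ = 1) :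
    (GGT.IsGGTRepresentation (fun _ => α) (fun _ => a) (GGT.constGGT α a) ∧
      GGT.constGGT α a = cfc (GGT.symbol a) GGT.T) ∧
    GGT.IsWeaklyPropagating (GGT.constGGT α a) (GGT.conjugateOp a) ∧
    (∀ Θ : Set GGT.Torus, MeasurableSet Θ →
      (GGT.arcLower a : GGT.Torus) ∉ closure Θ → (GGT.arcUpper a : GGT.Torus) ∉ closure Θ →
      GGT.IsStrictlyPropagatingOn (GGT.constGGT α a) (GGT.conjugateOp a) Θ) ∧
    GGT.HasPurelyACSpectrum (GGT.constGGT α a) :=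
  ⟨⟨GGT.isGGTRepresentation_constGGT ha h, GGT.constGGT_eq_cfc ha h⟩,
    GGT.isWeaklyPropagating_constGGT ha h,
    fun _ hΘ hl hu => GGT.isStrictlyPropagatingOn_constGGT ha h hΘ hl hu,
    GGT.hasPurelyACSpectrum_constGGT ha h⟩

theorem proposition5p2 (α : ℂ) (a : ℝ) (hα0 : α ≠ 0) (hα1 : ‖α‖ < 1) (ha : 1 < a)
    (h : ‖α‖ ^ 2 + (a ^ 2)⁻¹ = 1) :
    (GGT.IsGGTRepresentation (fun _ => α) (fun _ => a) (GGT.constGGT α a) ∧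
      GGT.constGGT α a = cfc (GGT.symbol a) GGT.T) ∧
    GGT.IsWeaklyPropagating (GGT.constGGT α a) (GGT.conjugateOp a) ∧
    (∀ Θ : Set GGT.Torus, GGT.IsArc Θ → Θ ⊆ GGT.arc a →
      (GGT.arcLower a : GGT.Torus) ∉ closure Θ → (GGT.arcUpper a : GGT.Torus) ∉ closure Θ →
      GGT.IsStrictlyPropagatingOn (GGT.constGGT α a) (GGT.conjugateOp a) Θ) ∧
    GGT.HasPurelyACSpectrum (GGT.constGGT α a) := by
  obtain ⟨hGGT, hweak, hstrict, hac⟩ := proposition5p2_general α a (ha.trans_le (le_abs_self a)) h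
  exact ⟨hGGT, hweak, fun Θ hΘ _ => hstrict Θ hΘ.measurableSet, hac⟩
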